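/- Let $M$ be a smooth manifold of dimension $n$ with tangent bundle $\tau:TM\to M$, and let $\mathring TM$ be the set of nonzero tangent vectors. Let $F:TM\to\mathbb R$ be a Finsler function: $F$ is smooth on $\mathring TM$; $F(\lambda v)=\lambda F(v)$ for all $v\in TM$ and $\lambda\ge 0$; and the metric tensor $g=\frac12\nabla^{\mathsf v}\nabla^{\mathsf v}F^2$, with components $g_{ij}=\frac12\,\partial^2F^2/\partial y^i\partial y^j$, is non-degenerate at every $v\in\mathring TM$ (positivity of $F$ is not required). All tensors below are tensors along $\mathring TM\to M$, i.e. their value at $v\in\mathring TM$ is a multilinear form on $T_{\tau(v)}M$; $(x^i,y^i)$ are the coordinates on $TM$ induced by a chart of $M$. Let $E=\frac12F^2$ and let $S=y^i\frac{\partial}{\partial x^i}-2G^i\frac{\partial}{\partial y^i}$ be the canonical spray, with $$G^i=\tfrac12 g^{ij}\Big(\frac{\partial^2E}{\partial x^r\partial y^j}y^r-\frac{\partial E}{\partial x^j}\Big).$$ Put $G^i_j=\partial G^i/\partial y^j$, $G^i_{jk}=\partial G^i_j/\partial y^k$ and $\frac{\delta}{\delta x^i}=\frac{\partial}{\partial x^i}-G^j_i\frac{\partial}{\partial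 y^j}$. For a type $\binom0s$ tensor $A$, the horizontal (h-Berwald) differential $\nabla^{\mathsf h}A$ and the vertical differential $\nabla^{\mathsf v}A$ are the type $\binom{0}{s+1}$ tensors with components $$(\nabla^{\mathsf h}A)_{ij_1\dots j_s}=\frac{\delta A_{j_1\dots j_s}}{\delta x^i}-\sum_{k=1}^sG^l_{ij_k}A_{j_1\dots l\dots j_s},\qquad(\nabla^{\mathsf v}A)_{ij_1\dots j_s}=\frac{\partial A_{j_1\dots j_s}}{\partial y^i},$$ where the index $l$ stands in the $k$-th place. The Landsberg tensor is $P=-\frac12\nabla^{\mathsf h}g$, and the stretch tensor $\Sigma$ is defined by $$\tfrac12\Sigma(X,Y,Z,U)=\nabla^{\mathsf h}P(X,Y,Z,U)-\nabla^{\mathsf h}P(Y,X,Z,U).$$ If the stretch tensor depends only on the position, i.e. $\nabla^{\mathsf v}\Sigma=0$ on $\mathring TM$, then $\Sigma=0$ on $\mathring TM$. -/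

import Mathlib

open scoped Manifold ContDiff

noncomputable section

namespace Finsler

/-! ### Geometry in a chart

`E` is the model space, `e x y` is the energy function at the base coordinate `x` and the fibre
coordinate `y`; it is only used for `x` in an open set and for `y ≠ 0`.  Everything is written
without indices: the dictionary with classical indices is given in the comments. -/

section InChart

variable {E : Type*} [NormedAddCommGroup E] [NormedSpace ℝ E]

/-- The metric tensor `g = ∇ᵛ∇ᵛ e`, that is `g_{ij} = ∂²e/∂yⁱ∂yʲ`. -/
def chartMetric (e : E → E → ℝ) (x y : E) : E →L[ℝ] E →L[ℝ] ℝ :=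
  fderiv ℝ (fderiv ℝ (e x)) y

/-- The covector `(∂²e/∂xʳ∂yʲ) yʳ - ∂e/∂xʲ`. -/
def chartEulerLagrange (e : E → E → ℝ) (x y : E) : E →L[ℝ] ℝ :=
  fderiv ℝ (fun x' => fderiv ℝ (e x') y) x y - fderiv ℝ (fun x' => e x' y) x

/-- The coefficients `Gⁱ = ½ gⁱʲ ((∂²e/∂xʳ∂yʲ) yʳ - ∂e/∂xʲ)` of the canonical spray
`S = yⁱ ∂/∂xⁱ - 2 Gⁱ ∂/∂yⁱ`, i.e. of the vector field with `i_S d d_J e = - d e`. -/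
def chartSpray (e : E → E → ℝ) (x y : E) : E :=
  (1 / 2 : ℝ) • (chartMetric e x y).inverse (chartEulerLagrange e x y)

/-- The Ehresmann connection of the canonical spray, `Gⁱ_j = ∂Gⁱ/∂yʲ`: the horizontal lift
`½ (Xᶜ + [Xᵛ, S])` of the constant vector field `u` is `(u, - chartConnection e x y u)`. -/
def chartConnection (e : E → E → ℝ) (x y : E) : E →L[ℝ] E :=
  fderiv ℝ (chartSpray e x) y

/-- The coefficients `Gⁱ_{jk} = ∂Gⁱ_j/∂yᵏ` of the horizontal Berwald derivative: for constant
vector fields `u`, `w`, the section `∇ʰ_u w` (whose vertical lift is `[uʰ, wᵛ]`) is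
`chartBerwald e x y u w`. -/
def chartBerwald (e : E → E → ℝ) (x y : E) : E →L[ℝ] E →L[ℝ] E :=
  fderiv ℝ (chartConnection e x) y

/-- The derivative `uʰ f` of a function along the horizontal lift of `u`,
`δf/δxⁱ = ∂f/∂xⁱ - Gʲ_i ∂f/∂yʲ`. -/
def chartHorizontal (e : E → E → ℝ) (f : E → E → ℝ) (x y u : E) : ℝ :=
  fderiv ℝ (fun x' => f x' y) x u - fderiv ℝ (f x) y (chartConnection e x y u)

/-- The Landsberg tensor `P = - ½ ∇ʰ g`. -/
def chartLandsberg (e : E → E → ℝ) (x y u w z : E) : ℝ :=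
  -(1 / 2) * (chartHorizontal e (fun x' y' => chartMetric e x' y' w z) x y u
    - chartMetric e x y (chartBerwald e x y u w) z
    - chartMetric e x y w (chartBerwald e x y u z))

/-- The h-Berwald differential `∇ʰP (u, w, z, t)` of the Landsberg tensor. -/
def chartLandsbergDiff (e : E → E → ℝ) (x y u w z t : E) : ℝ :=
  chartHorizontal e (fun x' y' => chartLandsberg e x' y' w z t) x y u
    - chartLandsberg e x y (chartBerwald e x y u w) z t
    - chartLandsberg e x y w (chartBerwald e x y u z) t
    - chartLandsberg e x y w z (chartBerwald e x y u t)

/-- The stretch tensor: `½ Σ(u, w, z, t) = ∇ʰP (u, w, z, t) - ∇ʰP (w, u, z, t)`. -/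
def chartStretch (e : E → E → ℝ) (x y u w z t : E) : ℝ :=
  2 * (chartLandsbergDiff e x y u w z t - chartLandsbergDiff e x y w u z t)

end InChart

/-! ### Finsler manifolds -/

section OnManifold

variable {E : Type*} [NormedAddCommGroup E] [NormedSpace ℝ E]
  {M : Type*} [TopologicalSpace M] [ChartedSpace E M] [IsManifold 𝓘(ℝ, E) ∞ M]

/-- The metric tensor `g_v (X, Y) = ½ Xᵛ (Yᵛ F²)` at a tangent vector `v` at `p`, where `Xᵛ` is
the derivative along the straight lines `t ↦ v + t X` of the tangent space at `p`. -/
def metricTensor (F : TangentBundle 𝓘(ℝ, E) M → ℝ) (p : M)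
    (v X Y : TangentSpace 𝓘(ℝ, E) p) : ℝ :=
  (1 / 2) * lineDeriv ℝ (fun w : TangentSpace 𝓘(ℝ, E) p =>
    lineDeriv ℝ (fun w' : TangentSpace 𝓘(ℝ, E) p => F ⟨p, w'⟩ ^ 2) w Y) v X

/-- Finsler functions: smooth off the zero section, positively homogeneous of degree one, with
fibrewise non-degenerate metric tensor.  Positivity is not required. -/
structure IsFinslerFunction (F : TangentBundle 𝓘(ℝ, E) M → ℝ) : Prop where
  smooth : ContMDiffOn 𝓘(ℝ, E).tangent 𝓘(ℝ, ℝ) ∞ F {v | v.2 ≠ 0}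
  homogeneous : ∀ (p : M) (v : TangentSpace 𝓘(ℝ, E) p) (c : ℝ), 0 ≤ c →
    F ⟨p, c • v⟩ = c * F ⟨p, v⟩
  nondegenerate : ∀ (p : M) (v : TangentSpace 𝓘(ℝ, E) p), v ≠ 0 →
    ∀ X : TangentSpace 𝓘(ℝ, E) p, (∀ Y, metricTensor F p v X Y = 0) → X = 0

/-- The energy `½ F²` in the coordinates `(x, y)` of the tangent bundle induced by the chart `φ`:
`(x, y)` stands for the tangent vector `d(φ⁻¹)_x y` at the point `φ⁻¹ x`. -/
def energyInChart (F : TangentBundle 𝓘(ℝ, E) M → ℝ) (φ : OpenPartialHomeomorph M E)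
    (x y : E) : ℝ :=
  (1 / 2) * F ⟨φ.symm x, mfderiv 𝓘(ℝ, E) 𝓘(ℝ, E) φ.symm x y⟩ ^ 2

/-- The value `Σ_v (X, Y, Z, U)` of the stretch tensor at a tangent vector `v ≠ 0` at `p`, for
tangent vectors `X, Y, Z, U` at `p`, computed in a chart `φ` around `p`. -/
def stretchTensor (F : TangentBundle 𝓘(ℝ, E) M → ℝ) (φ : OpenPartialHomeomorph M E) (p : M)
    (v X Y Z U : TangentSpace 𝓘(ℝ, E) p) : ℝ :=
  let d : E →L[ℝ] E := mfderiv 𝓘(ℝ, E) 𝓘(ℝ, E) φ p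
  chartStretch (energyInChart F φ) (φ p) (d v) (d X) (d Y) (d Z) (d U)

/-- The vertical differential `(∇ᵛA)_v (X, Y, Z, U, V) = Xᵛ (A (Y, Z, U, V))` of a type `(0, 4)`
tensor at `v`: since `∇ᵛ` annihilates basic sections, this is the derivative in the direction `X`,
inside the tangent space at `p`, of the components of `A` along fixed vectors. -/
def verticalDifferential {p : M}
    (A : (v Y Z U V : TangentSpace 𝓘(ℝ, E) p) → ℝ)
    (v X Y Z U V : TangentSpace 𝓘(ℝ, E) p) : ℝ :=
  lineDeriv ℝ (fun w : TangentSpace 𝓘(ℝ, E) p => A w Y Z U V) v X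

end OnManifold

end Finsler

end

namespace Finsler

/-! ### Functions of base and fibre coordinates -/

section Calculus

variable {E : Type*} [NormedAddCommGroup E] [NormedSpace ℝ E]
  {V : Type*} [NormedAddCommGroup V] [NormedSpace ℝ V]

open Function

/-! Let `δ` be the canonical section, whose value at `v` is `v` itself. The stretch tensor vanishes
as soon as its third argument is `δ`. Differentiating `Σ(X, Y, δ, U) = 0` vertically along `Z`, and
using `∇ᵛ_Z δ = Z`, gives `(∇ᵛ_Z Σ)(X, Y, δ, U) + Σ(X, Y, Z, U) = 0`, so `∇ᵛΣ = 0` forces `Σ = 0`.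

The vanishing on `δ` comes from two facts. First, `∇ʰδ = 0`, which is Euler's relation for the
1-homogeneous connection coefficients (`chartBerwald_self`). Second, the energy is constant along
horizontal lifts (`fderiv_horizontal_energy`), which follows from the Euler-Lagrange form of the
spray and the 2-homogeneity of the energy. Differentiating `uʰe = 0` vertically and using `g(δ, z) =
zᵛe` gives `P(u, δ, z) = 0` (`landsbergForm_self`). Since `∇ʰδ = 0`, this passes to `∇ʰP` and then
to `Σ`.

The argument is local and fibrewise: it runs in a single chart, where nondegeneracy of `g` and
finite dimension make the fibrewise Hessian invertible. -/

theorem fderiv_apply_self_of_homogeneous {f : E → V} {y : E} {k : ℕ}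
    (hf : DifferentiableAt ℝ f y) (h : ∀ c : ℝ, 0 < c → f (c • y) = c ^ k • f y) :
    fderiv ℝ f y y = (k : ℝ) • f y := by
  have h1 : HasDerivAt (fun c : ℝ => c • y) y 1 := by
    simpa using (hasDerivAt_id (1 : ℝ)).smul_const y
  have hf' : HasFDerivAt f (fderiv ℝ f y) ((1 : ℝ) • y) := by
    rw [one_smul]; exact hf.hasFDerivAt
  have h2 : HasDerivAt (fun c : ℝ => f (c • y)) (fderiv ℝ f y y) 1 :=
    hf'.comp_hasDerivAt (1 : ℝ) h1
  have h3 : HasDerivAt (fun c : ℝ => c ^ k • f y) ((k : ℝ) • f y) 1 := by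
    simpa using (hasDerivAt_pow k (1 : ℝ)).smul_const (f y)
  refine h2.unique (h3.congr_of_eventuallyEq ?_)
  filter_upwards [lt_mem_nhds (zero_lt_one (α := ℝ))] with c hc using h c hc

variable {Ω : Set (E × E)} {f : E → E → V} {x y : E}

theorem contDiffAt_uncurry (hΩ : IsOpen Ω) (hf : ContDiffOn ℝ ∞ (uncurry f) Ω)
    (hp : (x, y) ∈ Ω) : ContDiffAt ℝ ∞ (uncurry f) (x, y) :=
  hf.contDiffAt (hΩ.mem_nhds hp)

theorem hasFDerivAt_uncurry (hΩ : IsOpen Ω) (hf : ContDiffOn ℝ ∞ (uncurry f) Ω)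
    (hp : (x, y) ∈ Ω) : HasFDerivAt (uncurry f) (fderiv ℝ (uncurry f) (x, y)) (x, y) :=
  ((contDiffAt_uncurry hΩ hf hp).differentiableAt (by simp)).hasFDerivAt

theorem hasFDerivAt_fibre (hΩ : IsOpen Ω) (hf : ContDiffOn ℝ ∞ (uncurry f) Ω)
    (hp : (x, y) ∈ Ω) :
    HasFDerivAt (f x) ((fderiv ℝ (uncurry f) (x, y)).comp (ContinuousLinearMap.inr ℝ E E)) y :=
  HasFDerivAt.comp (f := fun y' => (x, y')) y (hasFDerivAt_uncurry hΩ hf hp)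
    (hasFDerivAt_prodMk_right x y)

theorem hasFDerivAt_base (hΩ : IsOpen Ω) (hf : ContDiffOn ℝ ∞ (uncurry f) Ω)
    (hp : (x, y) ∈ Ω) :
    HasFDerivAt (fun x' => f x' y)
      ((fderiv ℝ (uncurry f) (x, y)).comp (ContinuousLinearMap.inl ℝ E E)) x :=
  HasFDerivAt.comp (f := fun x' => (x', y)) x (hasFDerivAt_uncurry hΩ hf hp)
    (hasFDerivAt_prodMk_left x y)

theorem fderiv_fibre_apply (hΩ : IsOpen Ω) (hf : ContDiffOn ℝ ∞ (uncurry f) Ω)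
    (hp : (x, y) ∈ Ω) (z : E) : fderiv ℝ (f x) y z = fderiv ℝ (uncurry f) (x, y) (0, z) := by
  rw [(hasFDerivAt_fibre hΩ hf hp).fderiv]; simp

theorem fderiv_base_apply (hΩ : IsOpen Ω) (hf : ContDiffOn ℝ ∞ (uncurry f) Ω)
    (hp : (x, y) ∈ Ω) (z : E) :
    fderiv ℝ (fun x' => f x' y) x z = fderiv ℝ (uncurry f) (x, y) (z, 0) := by
  rw [(hasFDerivAt_base hΩ hf hp).fderiv]; simp

theorem contDiffOn_fderiv_uncurry (hΩ : IsOpen Ω) (hf : ContDiffOn ℝ ∞ (uncurry f) Ω) :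
    ContDiffOn ℝ ∞ (fderiv ℝ (uncurry f)) Ω :=
  hf.fderiv_of_isOpen hΩ (by simp)

theorem contDiffOn_fderiv_fibre (hΩ : IsOpen Ω) (hf : ContDiffOn ℝ ∞ (uncurry f) Ω) :
    ContDiffOn ℝ ∞ (uncurry fun x y => fderiv ℝ (f x) y) Ω :=
  ((contDiffOn_fderiv_uncurry hΩ hf).clm_comp contDiffOn_const).congr
    fun _ hp => (hasFDerivAt_fibre hΩ hf hp).fderiv

theorem contDiffOn_fderiv_base (hΩ : IsOpen Ω) (hf : ContDiffOn ℝ ∞ (uncurry f) Ω) :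
    ContDiffOn ℝ ∞ (uncurry fun x y => fderiv ℝ (fun x' => f x' y) x) Ω :=
  ((contDiffOn_fderiv_uncurry hΩ hf).clm_comp contDiffOn_const).congr
    fun _ hp => (hasFDerivAt_base hΩ hf hp).fderiv

/-- The second derivative is symmetric. -/
theorem fderiv_fderiv_uncurry_comm (hΩ : IsOpen Ω) (hf : ContDiffOn ℝ ∞ (uncurry f) Ω)
    (hp : (x, y) ∈ Ω) (a b : E × E) :
    fderiv ℝ (fderiv ℝ (uncurry f)) (x, y) a b = fderiv ℝ (fderiv ℝ (uncurry f)) (x, y) b a :=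
  ((contDiffAt_uncurry hΩ hf hp).isSymmSndFDerivAt
    (by rw [minSmoothness_of_isRCLikeNormedField]; exact WithTop.coe_le_coe.2 le_top)).eq a b

theorem fderiv_fderiv_fibre_comm (hΩ : IsOpen Ω) (hf : ContDiffOn ℝ ∞ (uncurry f) Ω)
    (hp : (x, y) ∈ Ω) (a b : E) :
    fderiv ℝ (fderiv ℝ (f x)) y a b = fderiv ℝ (fderiv ℝ (f x)) y b a := by
  have : ContDiffAt ℝ ∞ (f x) y :=
    (contDiffAt_uncurry hΩ hf hp).comp (f := fun y' => (x, y')) y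
      (contDiffAt_const.prodMk contDiffAt_id)
  exact (this.isSymmSndFDerivAt
    (by rw [minSmoothness_of_isRCLikeNormedField]; exact WithTop.coe_le_coe.2 le_top)).eq a b

theorem hasFDerivAt_fderiv_uncurry (hΩ : IsOpen Ω) (hf : ContDiffOn ℝ ∞ (uncurry f) Ω)
    (hp : (x, y) ∈ Ω) :
    HasFDerivAt (fderiv ℝ (uncurry f)) (fderiv ℝ (fderiv ℝ (uncurry f)) (x, y)) (x, y) :=
  (((contDiffOn_fderiv_uncurry hΩ hf).contDiffAt (hΩ.mem_nhds hp)).differentiableAt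
    (by simp)).hasFDerivAt

/-- Derivatives of functions agreeing on an open set agree. -/
theorem hasFDerivAt_unique_of_eqOn {G : Type*} [NormedAddCommGroup G] [NormedSpace ℝ G]
    {s : Set G} (hs : IsOpen s) {f₁ f₂ : G → V} (h : Set.EqOn f₁ f₂ s) {p : G} (hp : p ∈ s)
    {f₁' f₂' : G →L[ℝ] V} (h₁ : HasFDerivAt f₁ f₁' p) (h₂ : HasFDerivAt f₂ f₂' p) : f₁' = f₂' :=
  h₁.unique (h₂.congr_of_eventuallyEq (h.eventuallyEq_of_mem (hs.mem_nhds hp)))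

/-- Pure fibre and mixed base-fibre second derivatives thus become values of one symmetric form, the
total second derivative on `E × E`, so they can be interchanged freely. -/
theorem fderiv_uncurry_fderiv_fibre_apply (hΩ : IsOpen Ω) (hf : ContDiffOn ℝ ∞ (uncurry f) Ω)
    (hp : (x, y) ∈ Ω) (a : E × E) (z : E) :
    fderiv ℝ (uncurry fun x y => fderiv ℝ (f x) y) (x, y) a z =
      fderiv ℝ (fderiv ℝ (uncurry f)) (x, y) a (0, z) := by
  have h : HasFDerivAt (fun p : E × E =>
      (fderiv ℝ (uncurry f) p).comp (ContinuousLinearMap.inr ℝ E E)) _ (x, y) :=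
    (hasFDerivAt_fderiv_uncurry hΩ hf hp).clm_comp (hasFDerivAt_const _ _)
  rw [hasFDerivAt_unique_of_eqOn hΩ (fun p hp => (hasFDerivAt_fibre hΩ hf hp).fderiv) hp
    (hasFDerivAt_uncurry hΩ (contDiffOn_fderiv_fibre hΩ hf) hp) h]
  simp

end Calculus

/-! ### Energy functions in a chart -/

/-- The domain `U × (E ∖ 0)` of the coordinates of nonzero tangent vectors. -/
def slit {E : Type*} [NormedAddCommGroup E] (U : Set E) : Set (E × E) := U ×ˢ {0}ᶜ

/-- Smooth positively `2`-homogeneous functions with nondegenerate fibrewise Hessian. -/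
structure IsChartEnergy {E : Type*} [NormedAddCommGroup E] [NormedSpace ℝ E]
    (e : E → E → ℝ) (U : Set E) : Prop where
  isOpen : IsOpen U
  smooth : ContDiffOn ℝ ∞ (Function.uncurry e) (slit U)
  homogeneous : ∀ x ∈ U, ∀ c : ℝ, 0 < c → ∀ y, e x (c • y) = c ^ 2 * e x y
  invertible : ∀ x ∈ U, ∀ y, y ≠ 0 → (chartMetric e x y).IsInvertible

section Energy

variable {E : Type*} [NormedAddCommGroup E] [NormedSpace ℝ E]
  {e : E → E → ℝ} {U : Set E} {x y : E}

open Function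

namespace IsChartEnergy

theorem isOpen_slit (he : IsChartEnergy e U) : IsOpen (slit U) :=
  he.isOpen.prod isOpen_compl_singleton

/-! #### Homogeneity -/

/-- The chain rule applied to `e(c y) = c² e(y)`, with one factor `c` cancelled. The identity holds
for every `y` and `fderiv_comp_smul` needs no differentiability, so `y = 0` is not exceptional. The
same pattern gives the degrees 0 for the metric and 1 for the connection. -/
theorem fderiv_smul (he : IsChartEnergy e U) (hx : x ∈ U) {c : ℝ} (hc : 0 < c) (y : E) :
    fderiv ℝ (e x) (c • y) = c • fderiv ℝ (e x) y := by
  have h1 : (fun y => e x (c • y)) = c ^ 2 • e x := by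
    ext y; simp [he.homogeneous x hx c hc y]
  have h2 := fderiv_comp_smul (𝕜 := ℝ) (f := e x) (x := y) (c := c)
  rw [h1, fderiv_const_smul_field, pow_two, mul_smul] at h2
  exact (smul_right_injective _ hc.ne' h2).symm

theorem chartMetric_smul (he : IsChartEnergy e U) (hx : x ∈ U) {c : ℝ} (hc : 0 < c) (y : E) :
    chartMetric e x (c • y) = chartMetric e x y := by
  have h1 : (fun y => fderiv ℝ (e x) (c • y)) = c • fderiv ℝ (e x) := by
    ext1 y; exact he.fderiv_smul hx hc y
  have h2 := fderiv_comp_smul (𝕜 := ℝ) (f := fderiv ℝ (e x)) (x := y) (c := c)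
  rw [h1, fderiv_const_smul_field (F := E →L[ℝ] ℝ) c] at h2
  exact (smul_right_injective _ hc.ne' h2).symm

theorem chartEulerLagrange_smul (he : IsChartEnergy e U) (hx : x ∈ U) {c : ℝ} (hc : 0 < c)
    (y : E) : chartEulerLagrange e x (c • y) = c ^ 2 • chartEulerLagrange e x y := by
  have hU := he.isOpen.mem_nhds hx
  have h1 : (fun x' => fderiv ℝ (e x') (c • y)) =ᶠ[nhds x]
      (c • fun x' => fderiv ℝ (e x') y) := by
    filter_upwards [hU] with x' hx' using he.fderiv_smul hx' hc y
  have h2 : (fun x' => e x' (c • y)) =ᶠ[nhds x] (c ^ 2 • fun x' => e x' y) := by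
    filter_upwards [hU] with x' hx' using he.homogeneous x' hx' c hc y
  unfold chartEulerLagrange
  rw [h1.fderiv_eq, h2.fderiv_eq, fderiv_const_smul_field (F := E →L[ℝ] ℝ) c,
    fderiv_const_smul_field]
  ext z
  simp
  ring

theorem chartSpray_smul (he : IsChartEnergy e U) (hx : x ∈ U) {c : ℝ} (hc : 0 < c) (y : E) :
    chartSpray e x (c • y) = c ^ 2 • chartSpray e x y := by
  unfold chartSpray
  rw [he.chartMetric_smul hx hc, he.chartEulerLagrange_smul hx hc, map_smul, smul_comm]

theorem chartConnection_smul (he : IsChartEnergy e U) (hx : x ∈ U) {c : ℝ} (hc : 0 < c)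
    (y : E) : chartConnection e x (c • y) = c • chartConnection e x y := by
  have h1 : (fun y => chartSpray e x (c • y)) = c ^ 2 • chartSpray e x := by
    ext1 y; exact he.chartSpray_smul hx hc y
  have h2 := fderiv_comp_smul (𝕜 := ℝ) (f := chartSpray e x) (x := y) (c := c)
  rw [h1, fderiv_const_smul_field, pow_two, mul_smul] at h2
  exact (smul_right_injective _ hc.ne' h2).symm

/-! #### Smoothness -/

theorem contDiffOn_chartMetric (he : IsChartEnergy e U) :
    ContDiffOn ℝ ∞ (uncurry (chartMetric e)) (slit U) :=
  contDiffOn_fderiv_fibre (f := fun x y => fderiv ℝ (e x) y) he.isOpen_slit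
    (contDiffOn_fderiv_fibre he.isOpen_slit he.smooth)

theorem contDiffOn_chartEulerLagrange (he : IsChartEnergy e U) :
    ContDiffOn ℝ ∞ (uncurry (chartEulerLagrange e)) (slit U) := by
  have h := (contDiffOn_fderiv_base (f := fun x y => fderiv ℝ (e x) y) he.isOpen_slit
    (contDiffOn_fderiv_fibre he.isOpen_slit he.smooth)).clm_apply contDiffOn_snd
  exact h.sub (contDiffOn_fderiv_base he.isOpen_slit he.smooth)

/-- Inversion of operators is smooth at invertible ones; completeness of `E` enters here. -/
theorem contDiffOn_chartSpray [CompleteSpace E] (he : IsChartEnergy e U) :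
    ContDiffOn ℝ ∞ (uncurry (chartSpray e)) (slit U) := by
  have h : ContDiffOn ℝ ∞ (fun p : E × E => (chartMetric e p.1 p.2).inverse) (slit U) := by
    intro p hp
    obtain ⟨A, hA⟩ := he.invertible p.1 hp.1 p.2 hp.2
    have h1 : ContDiffAt ℝ ∞ ContinuousLinearMap.inverse (uncurry (chartMetric e) p) := by
      change ContDiffAt ℝ ∞ _ (chartMetric e p.1 p.2)
      rw [← hA]
      exact contDiffAt_map_inverse A
    exact h1.comp_contDiffWithinAt p (he.contDiffOn_chartMetric p hp)
  exact (h.clm_apply he.contDiffOn_chartEulerLagrange).const_smul (1 / 2 : ℝ)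

theorem contDiffOn_chartConnection [CompleteSpace E] (he : IsChartEnergy e U) :
    ContDiffOn ℝ ∞ (uncurry (chartConnection e)) (slit U) :=
  contDiffOn_fderiv_fibre he.isOpen_slit he.contDiffOn_chartSpray

theorem contDiffOn_chartBerwald [CompleteSpace E] (he : IsChartEnergy e U) :
    ContDiffOn ℝ ∞ (uncurry (chartBerwald e)) (slit U) :=
  contDiffOn_fderiv_fibre he.isOpen_slit he.contDiffOn_chartConnection

/-! #### Consequences of homogeneity -/

theorem chartBerwald_comm [CompleteSpace E] (he : IsChartEnergy e U) (hp : (x, y) ∈ slit U)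
    (a b : E) : chartBerwald e x y a b = chartBerwald e x y b a :=
  fderiv_fderiv_fibre_comm he.isOpen_slit he.contDiffOn_chartSpray hp a b

/-- This expresses `∇ʰδ = 0`. Euler's relation handles the slot in which the connection is
differentiated; symmetry of the Berwald coefficients moves `y` to the other slot. -/
theorem chartBerwald_self [CompleteSpace E] (he : IsChartEnergy e U) (hp : (x, y) ∈ slit U)
    (u : E) : chartBerwald e x y u y = chartConnection e x y u := by
  have h := fderiv_apply_self_of_homogeneous (k := 1)
    (hasFDerivAt_fibre he.isOpen_slit he.contDiffOn_chartConnection hp).differentiableAt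
    (fun c hc => by rw [he.chartConnection_smul hp.1 hc, pow_one])
  rw [he.chartBerwald_comm hp]
  simpa [chartBerwald] using congrArg (fun A : E →L[ℝ] E => A u) h

theorem chartMetric_apply (he : IsChartEnergy e U) (hp : (x, y) ∈ slit U) (w z : E) :
    chartMetric e x y w z = fderiv ℝ (fderiv ℝ (uncurry e)) (x, y) (0, w) (0, z) := by
  have h1 := fderiv_fibre_apply (f := fun x y => fderiv ℝ (e x) y) he.isOpen_slit
    (contDiffOn_fderiv_fibre he.isOpen_slit he.smooth) hp w
  rw [chartMetric]
  change fderiv ℝ (fun y => fderiv ℝ (e x) y) y w z = _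
  rw [h1, fderiv_uncurry_fderiv_fibre_apply he.isOpen_slit he.smooth hp]

theorem chartMetric_comm (he : IsChartEnergy e U) (hp : (x, y) ∈ slit U) (w z : E) :
    chartMetric e x y w z = chartMetric e x y z w :=
  fderiv_fderiv_fibre_comm he.isOpen_slit he.smooth hp w z

/-- Euler's relation for the energy. -/
theorem fderiv_vertical_self (he : IsChartEnergy e U) (hp : (x, y) ∈ slit U) :
    fderiv ℝ (uncurry e) (x, y) (0, y) = 2 * e x y := by
  rw [← fderiv_fibre_apply he.isOpen_slit he.smooth hp]
  simpa using fderiv_apply_self_of_homogeneous (k := 2)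
    (hasFDerivAt_fibre he.isOpen_slit he.smooth hp).differentiableAt
    (fun c hc => by simpa using he.homogeneous x hp.1 c hc y)

/-- The derivative of Euler's relation. -/
theorem fderiv_fderiv_vertical_self (he : IsChartEnergy e U) (hp : (x, y) ∈ slit U)
    (a : E × E) :
    fderiv ℝ (fderiv ℝ (uncurry e)) (x, y) a (0, y) + fderiv ℝ (uncurry e) (x, y) (0, a.2) =
      2 * fderiv ℝ (uncurry e) (x, y) a := by
  have h1 : HasFDerivAt (fun p : E × E => fderiv ℝ (uncurry e) p (0, p.2)) _ (x, y) :=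
    (hasFDerivAt_fderiv_uncurry he.isOpen_slit he.smooth hp).clm_apply
      ((hasFDerivAt_const (0 : E) (x, y)).prodMk hasFDerivAt_snd)
  have h2 := (hasFDerivAt_uncurry he.isOpen_slit he.smooth hp).const_mul (2 : ℝ)
  have h := hasFDerivAt_unique_of_eqOn he.isOpen_slit
    (fun p hp => he.fderiv_vertical_self (x := p.1) (y := p.2) hp) hp h1 h2
  have := congrArg (fun A : E × E →L[ℝ] ℝ => A a) h
  simp at this
  linarith

/-- The vertical part of the differentiated Euler relation: `g(δ, z) = zᵛe`. -/
theorem chartMetric_self (he : IsChartEnergy e U) (hp : (x, y) ∈ slit U) (z : E) :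
    chartMetric e x y y z = fderiv ℝ (uncurry e) (x, y) (0, z) := by
  rw [he.chartMetric_comm hp, he.chartMetric_apply hp]
  linarith [he.fderiv_fderiv_vertical_self hp (0, z)]

theorem chartEulerLagrange_apply (he : IsChartEnergy e U) (hp : (x, y) ∈ slit U) (z : E) :
    chartEulerLagrange e x y z = fderiv ℝ (fderiv ℝ (uncurry e)) (x, y) (y, 0) (0, z) -
      fderiv ℝ (uncurry e) (x, y) (z, 0) := by
  have h1 := fderiv_base_apply (f := fun x y => fderiv ℝ (e x) y) he.isOpen_slit
    (contDiffOn_fderiv_fibre he.isOpen_slit he.smooth) hp y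
  rw [chartEulerLagrange, sub_apply,
    fderiv_base_apply he.isOpen_slit he.smooth hp, h1,
    fderiv_uncurry_fderiv_fibre_apply he.isOpen_slit he.smooth hp]

theorem two_mul_chartMetric_chartSpray (he : IsChartEnergy e U) (hp : (x, y) ∈ slit U) (z : E) :
    2 * chartMetric e x y (chartSpray e x y) z = chartEulerLagrange e x y z := by
  obtain ⟨A, hA⟩ := he.invertible x hp.1 y hp.2
  rw [chartSpray, ← hA]
  simp

/-- The energy is a first integral of the spray. -/
theorem two_mul_fderiv_chartSpray (he : IsChartEnergy e U) (hp : (x, y) ∈ slit U) :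
    2 * fderiv ℝ (uncurry e) (x, y) (0, chartSpray e x y) =
      fderiv ℝ (uncurry e) (x, y) (y, 0) := by
  rw [← he.chartMetric_self hp, he.chartMetric_comm hp, he.two_mul_chartMetric_chartSpray hp,
    he.chartEulerLagrange_apply hp]
  -- The direction `(y, 0)` has no fibre component, so the correction term in the differentiated
  -- Euler relation drops out.
  have := he.fderiv_fderiv_vertical_self hp (y, 0)
  simp only [Prod.mk_zero_zero, map_zero] at this
  linarith

/-- The energy is constant along horizontal directions. -/
theorem fderiv_horizontal_energy [CompleteSpace E] (he : IsChartEnergy e U)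
    (hp : (x, y) ∈ slit U) (u : E) :
    fderiv ℝ (uncurry e) (x, y) (u, -chartConnection e x y u) = 0 := by
  have hD := hasFDerivAt_fderiv_uncurry he.isOpen_slit he.smooth hp
  have h1 : HasFDerivAt
      (fun p : E × E => 2 * fderiv ℝ (uncurry e) p (0, uncurry (chartSpray e) p)) _ (x, y) :=
    (hD.clm_apply ((hasFDerivAt_const (0 : E) (x, y)).prodMk
      (hasFDerivAt_uncurry he.isOpen_slit he.contDiffOn_chartSpray hp))).const_mul 2
  have h2 : HasFDerivAt (fun p : E × E => fderiv ℝ (uncurry e) p (p.2, 0)) _ (x, y) :=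
    hD.clm_apply (hasFDerivAt_snd.prodMk (hasFDerivAt_const (0 : E) (x, y)))
  have h := hasFDerivAt_unique_of_eqOn he.isOpen_slit
    (fun p hp => he.two_mul_fderiv_chartSpray (x := p.1) (y := p.2) hp) hp h1 h2
  -- Evaluation at `(0, u)` is the vertical derivative of `S e = 0`. Subtracting the Euler-Lagrange
  -- equation `h4` cancels the second-order terms and leaves twice the claim.
  have h3 := congrArg (fun A : E × E →L[ℝ] ℝ => A (0, u)) h
  simp [← fderiv_fibre_apply he.isOpen_slit he.contDiffOn_chartSpray hp] at h3
  have h4 := he.two_mul_chartMetric_chartSpray hp u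
  rw [he.chartMetric_comm hp, he.chartMetric_apply hp, he.chartEulerLagrange_apply hp,
    fderiv_fderiv_uncurry_comm he.isOpen_slit he.smooth hp (y, 0)] at h4
  have h5 : (u, -chartConnection e x y u) = (u, (0 : E)) - (0, chartConnection e x y u) := by
    simp
  rw [h5, map_sub]
  change _ - fderiv ℝ (uncurry e) (x, y) (0, fderiv ℝ (chartSpray e x) y u) = 0
  linarith

end IsChartEnergy

end Energy

end Finsler

noncomputable section

namespace Finsler

/-! ### The Landsberg and stretch tensors on the canonical section -/

section Stretch

variable {E : Type*} [NormedAddCommGroup E] [NormedSpace ℝ E]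
  {e : E → E → ℝ} {U : Set E} {x y : E}

open Function

/-- The Landsberg tensor as a linear form in its second argument. -/
def landsbergForm (e : E → E → ℝ) (p : E × E) (u z : E) : E →L[ℝ] ℝ :=
  -(1 / 2 : ℝ) • ((fderiv ℝ (uncurry (chartMetric e)) p
      (u, -chartConnection e p.1 p.2 u)).flip z
    - ((chartMetric e p.1 p.2).flip z).comp (chartBerwald e p.1 p.2 u)
    - (chartMetric e p.1 p.2).flip (chartBerwald e p.1 p.2 u z))

/-- The h-Berwald differential of the Landsberg tensor as a linear form in its third argument. -/
def landsbergDiffForm (e : E → E → ℝ) (p : E × E) (u w t : E) : E →L[ℝ] ℝ :=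
  fderiv ℝ (fun q => landsbergForm e q w t) p (u, -chartConnection e p.1 p.2 u)
    - landsbergForm e p (chartBerwald e p.1 p.2 u w) t
    - (landsbergForm e p w t).comp (chartBerwald e p.1 p.2 u)
    - landsbergForm e p w (chartBerwald e p.1 p.2 u t)

namespace IsChartEnergy

theorem chartHorizontal_eq (he : IsChartEnergy e U) (hp : (x, y) ∈ slit U) {f : E → E → ℝ}
    (hf : ContDiffOn ℝ ∞ (uncurry f) (slit U)) (u : E) :
    chartHorizontal e f x y u =
      fderiv ℝ (uncurry f) (x, y) (u, -chartConnection e x y u) := by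
  have h : (u, -chartConnection e x y u) = (u, (0 : E)) - (0, chartConnection e x y u) := by
    simp
  rw [chartHorizontal, fderiv_base_apply he.isOpen_slit hf hp,
    fderiv_fibre_apply he.isOpen_slit hf hp, h, map_sub]

theorem chartLandsberg_eq (he : IsChartEnergy e U) (hp : (x, y) ∈ slit U) (u w z : E) :
    chartLandsberg e x y u w z = landsbergForm e (x, y) u z w := by
  have hg := he.contDiffOn_chartMetric
  have h1 : ContDiffOn ℝ ∞ (uncurry fun x' y' => chartMetric e x' y' w z) (slit U) :=
    (hg.clm_apply contDiffOn_const).clm_apply contDiffOn_const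
  have h2 : HasFDerivAt (fun p => uncurry (chartMetric e) p w z) _ (x, y) :=
    ((hasFDerivAt_uncurry he.isOpen_slit hg hp).clm_apply
      (hasFDerivAt_const w (x, y))).clm_apply (hasFDerivAt_const z (x, y))
  have h3 : fderiv ℝ (uncurry fun x' y' => chartMetric e x' y' w z) (x, y) = _ := h2.fderiv
  rw [chartLandsberg, he.chartHorizontal_eq hp h1, h3]
  simp [landsbergForm]

variable [CompleteSpace E]

/-- The arguments may vary with the point because the correction terms of `∇ʰP` insert Berwald
coefficients into `P`. -/
theorem contDiffOn_landsbergForm (he : IsChartEnergy e U) {u z : E × E → E}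
    (hu : ContDiffOn ℝ ∞ u (slit U)) (hz : ContDiffOn ℝ ∞ z (slit U)) :
    ContDiffOn ℝ ∞ (fun p => landsbergForm e p (u p) (z p)) (slit U) := by
  have hg := he.contDiffOn_chartMetric
  have hN := he.contDiffOn_chartConnection
  have hB := he.contDiffOn_chartBerwald
  have hflip := LinearIsometryEquiv.contDiff (n := ∞) (𝕜 := ℝ) (E := E →L[ℝ] E →L[ℝ] ℝ)
    (F := E →L[ℝ] E →L[ℝ] ℝ) (ContinuousLinearMap.flipₗᵢ ℝ E E ℝ)
  have hgf := hflip.comp_contDiffOn hg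
  have h1 := hflip.comp_contDiffOn ((contDiffOn_fderiv_uncurry he.isOpen_slit hg).clm_apply
    (hu.prodMk (hN.clm_apply hu).neg))
  exact (((h1.clm_apply hz).sub ((hgf.clm_apply hz).clm_comp (hB.clm_apply hu))).sub
    (hgf.clm_apply ((hB.clm_apply hu).clm_apply hz))).const_smul (-(1 / 2 : ℝ))

theorem contDiffOn_landsbergDiffForm (he : IsChartEnergy e U) (u w t : E) :
    ContDiffOn ℝ ∞ (fun p => landsbergDiffForm e p u w t) (slit U) := by
  have hN := he.contDiffOn_chartConnection
  have hB := he.contDiffOn_chartBerwald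
  have hc : ∀ a : E, ContDiffOn ℝ ∞ (fun _ : E × E => a) (slit U) := fun a => contDiffOn_const
  have h0 := he.contDiffOn_landsbergForm (hc w) (hc t)
  exact (((((h0.fderiv_of_isOpen he.isOpen_slit (m := ∞) (by simp)).clm_apply
    ((hc u).prodMk (hN.clm_apply (hc u)).neg)).sub
    (he.contDiffOn_landsbergForm ((hB.clm_apply (hc u)).clm_apply (hc w)) (hc t))).sub
    (h0.clm_comp (hB.clm_apply (hc u)))).sub
    (he.contDiffOn_landsbergForm (hc w) ((hB.clm_apply (hc u)).clm_apply (hc t))))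

theorem chartLandsbergDiff_eq (he : IsChartEnergy e U) (hp : (x, y) ∈ slit U) (u w z t : E) :
    chartLandsbergDiff e x y u w z t = landsbergDiffForm e (x, y) u w t z := by
  have h0 := he.contDiffOn_landsbergForm (contDiffOn_const (c := w)) (contDiffOn_const (c := t))
  have h1 : Set.EqOn (uncurry fun x' y' => chartLandsberg e x' y' w z t)
      (fun p => landsbergForm e p w t z) (slit U) :=
    fun p hp => he.chartLandsberg_eq (x := p.1) (y := p.2) hp w z t
  have h2 : ContDiffOn ℝ ∞ (uncurry fun x' y' => chartLandsberg e x' y' w z t) (slit U) :=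
    (h0.clm_apply contDiffOn_const).congr h1
  have hp' := he.isOpen_slit.mem_nhds hp
  have h3 : HasFDerivAt (fun p => landsbergForm e p w t z) _ (x, y) :=
    ((h0.contDiffAt hp').differentiableAt (by simp)).hasFDerivAt.clm_apply
      (hasFDerivAt_const z (x, y))
  rw [chartLandsbergDiff, he.chartHorizontal_eq hp h2, (h1.eventuallyEq_of_mem hp').fderiv_eq,
    h3.fderiv]
  simp [landsbergDiffForm, he.chartLandsberg_eq hp]

theorem chartStretch_eq (he : IsChartEnergy e U) (hp : (x, y) ∈ slit U) (u w z t : E) :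
    chartStretch e x y u w z t =
      2 * (landsbergDiffForm e (x, y) u w t z - landsbergDiffForm e (x, y) w u t z) := by
  simp [chartStretch, he.chartLandsbergDiff_eq hp]

/-- The Landsberg tensor vanishes on the canonical section. -/
theorem landsbergForm_self (he : IsChartEnergy e U) (hp : (x, y) ∈ slit U) (u z : E) :
    landsbergForm e (x, y) u z y = 0 := by
  have hg := hasFDerivAt_uncurry he.isOpen_slit he.contDiffOn_chartMetric hp
  have hD := hasFDerivAt_fderiv_uncurry he.isOpen_slit he.smooth hp
  have hN := hasFDerivAt_uncurry he.isOpen_slit he.contDiffOn_chartConnection hp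
  have h1 : HasFDerivAt (fun p : E × E => uncurry (chartMetric e) p p.2 z) _ (x, y) :=
    (hg.clm_apply hasFDerivAt_snd).clm_apply (hasFDerivAt_const z (x, y))
  have h2 : HasFDerivAt (fun p : E × E => fderiv ℝ (uncurry e) p (0, z)) _ (x, y) :=
    hD.clm_apply (hasFDerivAt_const ((0 : E), z) (x, y))
  -- Horizontal derivative of `g(δ, z) = zᵛe`; the moving argument `δ` contributes `-g(N u, z)`,
  -- where `N` is the connection.
  have h3 := congrArg (fun A : E × E →L[ℝ] ℝ => A (u, -chartConnection e x y u))
    (hasFDerivAt_unique_of_eqOn he.isOpen_slit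
      (fun p hp => he.chartMetric_self (x := p.1) (y := p.2) hp z) hp h1 h2)
  have h4 : HasFDerivAt (fun p : E × E =>
      fderiv ℝ (uncurry e) p (u, -uncurry (chartConnection e) p u)) _ (x, y) :=
    hD.clm_apply ((hasFDerivAt_const u (x, y)).prodMk
      (hN.clm_apply (hasFDerivAt_const u (x, y))).neg)
  -- Vertical derivative along `z` of `uʰe = 0`. Its second-order term agrees with that of `h3` by
  -- symmetry of the second derivative (`h7`), and the rest is the Berwald correction.
  have h5 := congrArg (fun A : E × E →L[ℝ] ℝ => A (0, z))
    (hasFDerivAt_unique_of_eqOn he.isOpen_slit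
      (fun p hp => he.fderiv_horizontal_energy (x := p.1) (y := p.2) hp u) hp h4
      (hasFDerivAt_const (0 : ℝ) (x, y)))
  have h6 := fderiv_fibre_apply he.isOpen_slit he.contDiffOn_chartConnection hp z
  have h7 := fderiv_fderiv_uncurry_comm he.isOpen_slit he.smooth hp (0, z)
    (u, -chartConnection e x y u)
  have h8 := he.chartBerwald_comm hp u z
  have h9 := he.chartMetric_self hp (chartBerwald e x y z u)
  have h10 : ((0 : E), -chartBerwald e x y z u) = -(0, chartBerwald e x y z u) := by simp
  change chartBerwald e x y z = _ at h6
  simp at h3 h5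
  rw [← h6, h10, map_neg, h7] at h5
  simp [landsbergForm, he.chartBerwald_self hp, h8, h9]
  linarith

/-- The h-Berwald differential of the Landsberg tensor vanishes on the canonical section. -/
theorem landsbergDiffForm_self (he : IsChartEnergy e U) (hp : (x, y) ∈ slit U) (u w t : E) :
    landsbergDiffForm e (x, y) u w t y = 0 := by
  have h0 := he.contDiffOn_landsbergForm (contDiffOn_const (c := w)) (contDiffOn_const (c := t))
  have h1 : HasFDerivAt (fun p : E × E => landsbergForm e p w t p.2) _ (x, y) :=
    ((h0.contDiffAt (he.isOpen_slit.mem_nhds hp)).differentiableAt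
      (by simp)).hasFDerivAt.clm_apply hasFDerivAt_snd
  -- Differentiating `P(w, δ, t) = 0` horizontally: the moving `δ` gives `-P(w, N u, t)`, with `N`
  -- the connection, which is exactly the Berwald correction in the slot of `δ`.
  have h2 := congrArg (fun A : E × E →L[ℝ] ℝ => A (u, -chartConnection e x y u))
    (hasFDerivAt_unique_of_eqOn he.isOpen_slit
      (fun p hp => he.landsbergForm_self (x := p.1) (y := p.2) hp w t) hp h1
      (hasFDerivAt_const (0 : ℝ) (x, y)))
  simp at h2
  simp [landsbergDiffForm, he.landsbergForm_self hp, he.chartBerwald_self hp]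
  linarith

theorem chartStretch_self (he : IsChartEnergy e U) (hp : (x, y) ∈ slit U) (u w t : E) :
    chartStretch e x y u w y t = 0 := by
  simp [he.chartStretch_eq hp, he.landsbergDiffForm_self hp]

/-- If the vertical derivative of the stretch tensor along `z` vanishes on the canonical section,
then so does the stretch tensor on `z`. -/
theorem chartStretch_eq_zero_of_lineDeriv (he : IsChartEnergy e U) (hp : (x, y) ∈ slit U)
    (u w z t : E) (h : lineDeriv ℝ (fun y' => chartStretch e x y' u w y t) y z = 0) :
    chartStretch e x y u w z t = 0 := by
  set L : E × E → E →L[ℝ] ℝ := fun p =>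
    (2 : ℝ) • (landsbergDiffForm e p u w t - landsbergDiffForm e p w u t) with hL
  have hS : ∀ y' ∈ ({0}ᶜ : Set E), ∀ a, chartStretch e x y' u w a t = L (x, y') a := by
    intro y' hy' a
    rw [he.chartStretch_eq (y := y') ⟨hp.1, hy'⟩]
    simp [hL]
  have hLc : ContDiffOn ℝ ∞ L (slit U) :=
    ((he.contDiffOn_landsbergDiffForm u w t).sub
      (he.contDiffOn_landsbergDiffForm w u t)).const_smul (2 : ℝ)
  have hLd : HasFDerivAt (fun y' => L (x, y')) _ y :=
    HasFDerivAt.comp (f := fun y' => (x, y')) y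
      ((hLc.contDiffAt (he.isOpen_slit.mem_nhds hp)).differentiableAt (by simp)).hasFDerivAt
      (hasFDerivAt_prodMk_right x y)
  -- The derivative of `Σ(u, w, δ, t)` has two terms by the product rule: the one with the argument
  -- frozen at `y`, computed by `h2`, and `Σ(u, w, z, t)`.
  have h1 : HasFDerivAt (fun y' => L (x, y') y') _ y := hLd.clm_apply (hasFDerivAt_id y)
  have h2 : HasFDerivAt (fun y' => L (x, y') y) _ y :=
    hLd.clm_apply (hasFDerivAt_const y y)
  have h3 := congrArg (fun A : E →L[ℝ] ℝ => A z)
    (hasFDerivAt_unique_of_eqOn isOpen_compl_singleton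
      (fun y' hy' => (hS y' hy' y').symm.trans
        (he.chartStretch_self (x := x) (y := y') ⟨hp.1, hy'⟩ u w t)) hp.2 h1
      (hasFDerivAt_const (0 : ℝ) y))
  have h4 := (h2.congr_of_eventuallyEq
    ((show Set.EqOn (fun y' => chartStretch e x y' u w y t) (fun y' => L (x, y') y) {0}ᶜ from
      fun y' hy' => hS y' hy' y).eventuallyEq_of_mem
      (isOpen_compl_singleton.mem_nhds hp.2))).hasLineDerivAt z
  rw [h4.lineDeriv] at h
  rw [hS y hp.2]
  simp at h3 h
  linarith

end IsChartEnergy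

end Stretch

end Finsler

end

namespace Finsler

/-! ### Passage to a chart -/

section Transfer

variable {E : Type*} [NormedAddCommGroup E] [NormedSpace ℝ E]
  {M : Type*} [TopologicalSpace M] [ChartedSpace E M]

theorem mdifferentiable_of_mem_maximalAtlas {φ : OpenPartialHomeomorph M E}
    (hφ : φ ∈ IsManifold.maximalAtlas 𝓘(ℝ, E) ∞ M) :
    φ.MDifferentiable 𝓘(ℝ, E) 𝓘(ℝ, E) :=
  ⟨(contMDiffOn_of_mem_maximalAtlas hφ).mdifferentiableOn (by simp),
    (contMDiffOn_symm_of_mem_maximalAtlas hφ).mdifferentiableOn (by simp)⟩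

variable [IsManifold 𝓘(ℝ, E) ∞ M]

theorem mfderiv_chart_symm_ne_zero {φ : OpenPartialHomeomorph M E}
    (hφ : φ ∈ IsManifold.maximalAtlas 𝓘(ℝ, E) ∞ M) {x y : E} (hx : x ∈ φ.target) (hy : y ≠ 0) :
    (mfderiv 𝓘(ℝ, E) 𝓘(ℝ, E) φ.symm x : E →L[ℝ] E) y ≠ 0 := by
  have : IsManifold 𝓘(ℝ, E) 1 M := IsManifold.of_le (n := ∞) (by simp)
  have h := (mdifferentiable_of_mem_maximalAtlas hφ).symm.mfderiv_injective hx
  exact fun h0 => hy (h (h0.trans (map_zero (mfderiv 𝓘(ℝ, E) 𝓘(ℝ, E) φ.symm x)).symm))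

/-- The coordinate map `Ψ` is the tangent map of the inverse chart; it is smooth and, being
fibrewise injective, avoids the zero section, off which `F` is smooth. -/
theorem contDiffOn_energyInChart {F : TangentBundle 𝓘(ℝ, E) M → ℝ} (hF : IsFinslerFunction F)
    {φ : OpenPartialHomeomorph M E} (hφ : φ ∈ IsManifold.maximalAtlas 𝓘(ℝ, E) ∞ M) :
    ContDiffOn ℝ ∞ (Function.uncurry (energyInChart F φ)) (slit φ.target) := by
  have : IsManifold 𝓘(ℝ, E) 1 M := IsManifold.of_le (n := ∞) (by simp)
  have h1 := (contMDiffOn_symm_of_mem_maximalAtlas hφ).contMDiffOn_tangentMapWithin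
    (m := ∞) (by simp) φ.open_target.uniqueMDiffOn
  have h2 : ContMDiffOn (𝓘(ℝ, E).prod 𝓘(ℝ, E)) 𝓘(ℝ, E).tangent ∞
      ((tangentBundleModelSpaceHomeomorph 𝓘(ℝ, E)).symm : ModelProd E E → _)
      (slit φ.target) :=
    contMDiff_tangentBundleModelSpaceHomeomorph_symm.contMDiffOn
  let Ψ : ModelProd E E → TangentBundle 𝓘(ℝ, E) M := fun p =>
    ⟨φ.symm p.1, mfderiv 𝓘(ℝ, E) 𝓘(ℝ, E) φ.symm p.1 p.2⟩
  have h3 : ContMDiffOn (𝓘(ℝ, E).prod 𝓘(ℝ, E)) 𝓘(ℝ, E).tangent ∞ Ψ (slit φ.target) := by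
    have h4 : ∀ q : TangentBundle 𝓘(ℝ, E) E, q.1 ∈ φ.target →
        tangentMap 𝓘(ℝ, E) 𝓘(ℝ, E) φ.symm q =
          tangentMapWithin 𝓘(ℝ, E) 𝓘(ℝ, E) φ.symm φ.target q := fun q hq =>
      (tangentMapWithin_eq_tangentMap (φ.open_target.uniqueMDiffOn q.1 hq)
        ((mdifferentiable_of_mem_maximalAtlas hφ).mdifferentiableAt_symm hq)).symm
    exact (h1.comp h2 (fun p hp => hp.1)).congr fun p hp => h4 ⟨p.1, p.2⟩ hp.1
  have hΨ : ∀ p ∈ slit φ.target, (Ψ p).2 ≠ 0 :=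
    fun p hp => mfderiv_chart_symm_ne_zero hφ hp.1 hp.2
  have h5 : ContMDiffOn (𝓘(ℝ, E).prod 𝓘(ℝ, E)) 𝓘(ℝ, ℝ) ∞ (fun p => F (Ψ p))
      (slit φ.target) := hF.smooth.comp h3 hΨ
  rw [← modelWithCornersSelf_prod] at h5
  have h6 : ContDiffOn ℝ ∞ (fun p : E × E => F (Ψ p)) (slit φ.target) :=
    contMDiffOn_iff_contDiffOn.1 h5
  exact (h6.pow 2).const_smul (1 / 2 : ℝ)

theorem lineDeriv_comp_linear {V W : Type*} [AddCommGroup V] [Module ℝ V] [AddCommGroup W]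
    [Module ℝ W] (A : V →ₗ[ℝ] W) (f : W → ℝ) (v z : V) :
    lineDeriv ℝ (fun v => f (A v)) v z = lineDeriv ℝ f (A v) (A z) := by
  simp [lineDeriv]

theorem isChartEnergy_energyInChart [FiniteDimensional ℝ E]
    {F : TangentBundle 𝓘(ℝ, E) M → ℝ} (hF : IsFinslerFunction F)
    {φ : OpenPartialHomeomorph M E} (hφ : φ ∈ IsManifold.maximalAtlas 𝓘(ℝ, E) ∞ M) :
    IsChartEnergy (energyInChart F φ) φ.target where
  isOpen := φ.open_target
  smooth := contDiffOn_energyInChart hF hφ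
  homogeneous x hx c hc y := by
    have h := hF.homogeneous (φ.symm x) (mfderiv 𝓘(ℝ, E) 𝓘(ℝ, E) φ.symm x y) c hc.le
    have h2 : mfderiv 𝓘(ℝ, E) 𝓘(ℝ, E) φ.symm x (c • y) =
      c • mfderiv 𝓘(ℝ, E) 𝓘(ℝ, E) φ.symm x y := map_smul _ c y
    unfold energyInChart
    rw [h2, h]
    ring
  invertible x hx y hy := by
    have : IsManifold 𝓘(ℝ, E) 1 M := IsManifold.of_le (n := ∞) (by simp)
    set e := energyInChart F φ
    let A := (mdifferentiable_of_mem_maximalAtlas hφ).symm.mfderiv hx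
    have hs := contDiffOn_energyInChart hF hφ
    have hΩ : IsOpen (slit φ.target) := φ.open_target.prod isOpen_compl_singleton
    have hAy : (A : E → TangentSpace 𝓘(ℝ, E) (φ.symm x)) y ≠ 0 :=
      mfderiv_chart_symm_ne_zero hφ hx hy
    -- Line derivatives pull back along the linear isomorphism `A`, and off zero they agree with the
    -- Fréchet derivatives defining `chartMetric`. The factor `1/2` of the energy becomes that of
    -- `metricTensor`.
    have hg : ∀ w z : E, chartMetric e x y w z = metricTensor F (φ.symm x) (A y) (A w) (A z) := by
      intro w z
      have h1 : ∀ y' : E, lineDeriv ℝ (e x) y' z = (1 / 2) * lineDeriv ℝ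
          (fun w' : TangentSpace 𝓘(ℝ, E) (φ.symm x) => F ⟨φ.symm x, w'⟩ ^ 2) (A y') (A z) := by
        intro y'
        refine Eq.trans ?_ (congrArg ((1 / 2) * ·) (lineDeriv_comp_linear A.toLinearMap _ y' z))
        exact deriv_const_mul_field (1 / 2 : ℝ)
      have h2 : lineDeriv ℝ (fun y' => lineDeriv ℝ (e x) y' z) y w =
          metricTensor F (φ.symm x) (A y) (A w) (A z) := by
        simp only [h1]
        refine Eq.trans (deriv_const_mul_field (1 / 2 : ℝ)) ?_
        exact congrArg ((1 / 2) * ·) (lineDeriv_comp_linear A.toLinearMap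
          (fun v => lineDeriv ℝ
            (fun w' : TangentSpace 𝓘(ℝ, E) (φ.symm x) => F ⟨φ.symm x, w'⟩ ^ 2) v (A z)) y w)
      rw [← h2]
      have h3 := (hasFDerivAt_fibre (f := fun x y => fderiv ℝ (e x) y) hΩ
        (contDiffOn_fderiv_fibre hΩ hs) (x := x) (y := y) ⟨hx, hy⟩).differentiableAt.hasFDerivAt
      have h4 : HasFDerivAt (fun y' => fderiv ℝ (e x) y' z) _ y :=
        h3.clm_apply (hasFDerivAt_const z y)
      have h5 : (fun y' => lineDeriv ℝ (e x) y' z) =ᶠ[nhds y]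
          fun y' => fderiv ℝ (e x) y' z := by
        filter_upwards [isOpen_compl_singleton.mem_nhds hy] with y' hy'
        exact (hasFDerivAt_fibre hΩ hs (x := x) (y := y')
          ⟨hx, hy'⟩).differentiableAt.lineDeriv_eq_fderiv
      rw [((h4.congr_of_eventuallyEq h5).hasLineDerivAt w).lineDeriv]
      simp [chartMetric]
    have hinj : Function.Injective
        ((chartMetric e x y).toLinearMap : E →ₗ[ℝ] E →L[ℝ] ℝ) := by
      refine (injective_iff_map_eq_zero _).2 fun w hw => ?_
      have h0 : A w = 0 := hF.nondegenerate (φ.symm x) (A y) hAy (A w) fun Y => by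
        have h6 := hg w (A.symm Y)
        rw [A.apply_symm_apply] at h6
        rw [← h6]
        exact congrArg (fun B : E →L[ℝ] ℝ => B (A.symm Y)) hw
      exact (map_eq_zero_iff A A.injective).1 h0
    -- Nondegeneracy gives only injectivity; equality of the dimensions of `E` and its dual makes
    -- the Hessian invertible.
    have hfin : Module.finrank ℝ E = Module.finrank ℝ (E →L[ℝ] ℝ) := by
      rw [← (LinearMap.toContinuousLinearMap (𝕜 := ℝ) (E := E) (F' := ℝ)).finrank_eq]
      exact (Subspace.dual_finrank_eq (K := ℝ) (V := E)).symm
    refine ⟨(LinearEquiv.ofInjectiveOfFinrankEq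
      (chartMetric e x y).toLinearMap hinj hfin).toContinuousLinearEquiv, ?_⟩
    ext w z
    rfl

end Transfer

end Finsler

theorem mainTheorem4 {E : Type*} [NormedAddCommGroup E] [NormedSpace ℝ E] [FiniteDimensional ℝ E]
    {M : Type*} [TopologicalSpace M] [ChartedSpace E M] [IsManifold 𝓘(ℝ, E) ∞ M]
    (F : TangentBundle 𝓘(ℝ, E) M → ℝ) (hF : Finsler.IsFinslerFunction F)
    -- an arbitrary smooth chart around each point, in which the stretch tensor is computed there
    (φ : M → OpenPartialHomeomorph M E)
    (hφ : ∀ p : M, φ p ∈ IsManifold.maximalAtlas 𝓘(ℝ, E) ∞ M)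
    (hp : ∀ p : M, p ∈ (φ p).source)
    (h : ∀ (p : M) (v : TangentSpace 𝓘(ℝ, E) p), v ≠ 0 →
      ∀ X Y Z U V : TangentSpace 𝓘(ℝ, E) p,
        Finsler.verticalDifferential (Finsler.stretchTensor F (φ p) p) v X Y Z U V = 0) :
    ∀ (p : M) (v : TangentSpace 𝓘(ℝ, E) p), v ≠ 0 →
      ∀ X Y Z U : TangentSpace 𝓘(ℝ, E) p,
        Finsler.stretchTensor F (φ p) p v X Y Z U = 0 := by
  intro p v hv X Y Z U
  have : IsManifold 𝓘(ℝ, E) 1 M := IsManifold.of_le (n := ∞) (by simp)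
  let d := (Finsler.mdifferentiable_of_mem_maximalAtlas (hφ p)).mfderiv (hp p)
  have hdv : (d v : E) ≠ 0 := fun h0 => hv (d.injective (h0.trans (map_zero d).symm))
  refine (Finsler.isChartEnergy_energyInChart hF (hφ p)).chartStretch_eq_zero_of_lineDeriv
    (x := φ p p) (y := d v) ⟨(φ p).map_source (hp p), hdv⟩ (d X) (d Y) (d Z) (d U) ?_
  -- The hypothesis is used in the direction `Z` with the third argument frozen at `v`. It concerns
  -- the same chart `φ p` as the goal, so no change of chart intervenes.
  exact (Finsler.lineDeriv_comp_linear (W := E) d.toLinearMap _ v Z).symm.trans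
    (h p v hv Z X Y v U)
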